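/- Let $\mathcal H=\ell^2(\mathbb N,\mathbb C)$ be the Hilbert space of one bosonic mode with Fock basis $(|n\rangle)_{n\ge 0}$, and let $a_1,a_2$ be the annihilation operators of two modes on $\mathcal H\otimes\mathcal H$. For $T\in[0,1]$ let $B(T)=\exp\bigl(\arccos\sqrt T\,(a_1a_2^\dagger-a_1^\dagger a_2)\bigr)$ be the beam splitter with transmission probability $T$, and for a state (density operator: positive, trace class, trace one) $\rho$ on $\mathcal H$ let $$\rho_T=\mathrm{Tr}_2\bigl[B(T)\,(\rho\otimes|0\rangle\langle 0|)\,B(T)^\dagger\bigr]$$ be the state after loss with transmission probability $T$ (loss probability $1-T$). Let $\rho,\sigma$ be any two states on $\mathcal H$ and let $O_T=\mathrm{Tr}[\sigma_T^\dagger\rho_T]=\mathrm{Tr}[\sigma_T\rho_T]$ be their overlap (Hilbert-Schmidt inner product) after equal loss. Then: 1. There are coefficients $p_m\ge 0$ ($m\ge 0$), depending only on $\rho$ and $\sigma$, such that $O_T=\sum_{m\ge 0}p_m\,(1-2T)^m$ for all $T\in[0,1]$, the series being convergent (with $0^0=1$). 2. On the interval $0\le T\le \tfrac12$, the function $T\mapsto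 O_T$ is nonincreasing and convex. 3. In particular, on $0\le T\le\tfrac12$ the purity $\mathcal P(\rho_T)=\mathrm{Tr}[\rho_T^2]$ of any (mixed) state $\rho$ is nonincreasing and convex in $T$. -/

import Mathlib

open scoped Matrix InnerProductSpace ENNReal

noncomputable section

namespace BosonicLoss

/-! ### One and two bosonic modes in the Fock (photon-number) basis -/

/-- The Hilbert space of one bosonic mode; the `n`-th coordinate is the amplitude of the
Fock state with `n` photons. -/
abbrev OneMode : Type := lp (fun _ : ℕ => ℂ) 2

/-- The Hilbert space of two bosonic modes; the coordinate `(j, l)` is the amplitude of the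
Fock state `|j, l⟩`. -/
abbrev TwoMode : Type := lp (fun _ : ℕ × ℕ => ℂ) 2

/-- The Fock state `|n⟩`. -/
def fock (n : ℕ) : OneMode := lp.single 2 n (1 : ℂ)

/-- The trace of an operator on one mode, computed in the Fock basis. -/
def trace (A : OneMode →L[ℂ] OneMode) : ℂ := ∑' n, ⟪fock n, A (fock n)⟫_ℂ

/-- Density operators: positive operators that are trace class with trace one. -/
structure IsState (ρ : OneMode →L[ℂ] OneMode) : Prop where
  isPositive : ρ.IsPositive
  hasSum_trace : HasSum (fun n => ⟪fock n, ρ (fock n)⟫_ℂ) 1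

/-- The Hilbert-Schmidt inner product `Tr[σ† ρ]` of two operators. -/
def hsInner (σ ρ : OneMode →L[ℂ] OneMode) : ℂ :=
  trace (ContinuousLinearMap.adjoint σ ∘L ρ)

/-- The purity `Tr[ρ²]` of a state. -/
def purity (ρ : OneMode →L[ℂ] OneMode) : ℝ := (trace (ρ ∘L ρ)).re

/-! ### Ladder operators, on arbitrary families of amplitudes of two modes -/

/-- The annihilation operator `a₁`. -/
def ann1 (ψ : ℕ × ℕ → ℂ) : ℕ × ℕ → ℂ := fun p => (√((p.1 : ℝ) + 1) : ℝ) * ψ (p.1 + 1, p.2)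

/-- The annihilation operator `a₂`. -/
def ann2 (ψ : ℕ × ℕ → ℂ) : ℕ × ℕ → ℂ := fun p => (√((p.2 : ℝ) + 1) : ℝ) * ψ (p.1, p.2 + 1)

/-- The creation operator `a₁†` (its value at `(0, l)` is `0`). -/
def cre1 (ψ : ℕ × ℕ → ℂ) : ℕ × ℕ → ℂ := fun p => (√(p.1 : ℝ) : ℝ) * ψ (p.1 - 1, p.2)

/-- The creation operator `a₂†` (its value at `(j, 0)` is `0`). -/
def cre2 (ψ : ℕ × ℕ → ℂ) : ℕ × ℕ → ℂ := fun p => (√(p.2 : ℝ) : ℝ) * ψ (p.1, p.2 - 1)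

/-- The generator `a₁ a₂† - a₁† a₂` of the beam splitters. -/
def bsGenerator (ψ : ℕ × ℕ → ℂ) : ℕ × ℕ → ℂ := ann1 (cre2 ψ) - cre1 (ann2 ψ)

/-! ### The beam splitter

The generator preserves the total photon number `N`, so its exponential is the direct sum of
the exponentials of its blocks, the block `N` being spanned by the `|i, N - i⟩` with `i ≤ N`. -/

/-- The matrix of the generator on the sector with `N` photons in total:
the entry `(j, i)` is `⟨j, N - j| a₁ a₂† - a₁† a₂ |i, N - i⟩`. -/
def bsMatrix (N : ℕ) : Matrix (Fin (N + 1)) (Fin (N + 1)) ℂ :=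
  Matrix.of fun j i =>
    bsGenerator (Pi.single ((i : ℕ), N - (i : ℕ)) 1) ((j : ℕ), N - (j : ℕ))

/-- The exponential of `θ (a₁ a₂† - a₁† a₂)` on the sector with `N` photons in total. -/
def bsBlock (θ : ℝ) (N : ℕ) : Matrix (Fin (N + 1)) (Fin (N + 1)) ℂ :=
  NormedSpace.exp ((θ : ℂ) • bsMatrix N)

/-- The action of `exp (θ (a₁ a₂† - a₁† a₂))` on families of amplitudes. -/
def bsFun (θ : ℝ) (ψ : ℕ × ℕ → ℂ) : ℕ × ℕ → ℂ := fun p =>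
  (bsBlock θ (p.1 + p.2) *ᵥ fun i => ψ ((i : ℕ), p.1 + p.2 - (i : ℕ)))
    ⟨p.1, Nat.lt_succ_of_le (Nat.le_add_right _ _)⟩

theorem bsMatrix_conjTranspose (N : ℕ) : (bsMatrix N)ᴴ = -bsMatrix N := by
  ext j i
  obtain ⟨j, hj⟩ := j
  obtain ⟨i, hi⟩ := i
  simp only [Matrix.conjTranspose_apply, Matrix.neg_apply, bsMatrix, Matrix.of_apply,
    bsGenerator, ann1, ann2, cre1, cre2, Pi.sub_apply, Pi.single_apply, Prod.mk.injEq]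
  by_cases h1 : j = i + 1
  · subst h1
    have e1 : ((N - i : ℕ) : ℝ) = ((N - (i + 1) : ℕ) : ℝ) + 1 := by
      have : N - i = (N - (i + 1)) + 1 := by omega
      rw [this]; push_cast; ring
    have a1 : N - i - 1 = N - (i + 1) := by omega
    have a2 : N - (i + 1) + 1 = N - i := by omega
    have a3 : ¬ (i + 1 + 1 = i) := by omega
    have a4 : ¬ (i - 1 = i + 1) := by omega
    simp [e1, a1, a2, a3, a4, mul_comm]
  · by_cases h2 : i = j + 1
    · subst h2
      have e1 : ((N - j : ℕ) : ℝ) = ((N - (j + 1) : ℕ) : ℝ) + 1 := by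
        have : N - j = (N - (j + 1)) + 1 := by omega
        rw [this]; push_cast; ring
      have a1 : N - j - 1 = N - (j + 1) := by omega
      have a2 : N - (j + 1) + 1 = N - j := by omega
      have a3 : ¬ (j + 1 + 1 = j) := by omega
      have a4 : ¬ (j - 1 = j + 1) := by omega
      simp [e1, a1, a2, a3, a4, mul_comm]
    · have b1 : ¬ (i + 1 = j) := fun h => h1 h.symm
      have b2 : ¬ (j + 1 = i) := fun h => h2 h.symm
      have c1 : ((√(i : ℝ) : ℝ) : ℂ) * (if i - 1 = j ∧ N - i + 1 = N - j then (1 : ℂ) else 0)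
          = 0 := by
        rcases Nat.eq_zero_or_pos i with h | h
        · subst h; simp
        · rw [if_neg (by omega), mul_zero]
      have c2 : ((√(j : ℝ) : ℝ) : ℂ) * (if j - 1 = i ∧ N - j + 1 = N - i then (1 : ℂ) else 0)
          = 0 := by
        rcases Nat.eq_zero_or_pos j with h | h
        · subst h; simp
        · rw [if_neg (by omega), mul_zero]
      rw [mul_left_comm]
      simp only [b1, b2, false_and, if_false, mul_zero, zero_sub]
      rw [mul_left_comm, c1, mul_left_comm, c2]
      simp

theorem bsBlock_unitary (θ : ℝ) (N : ℕ) : (bsBlock θ N)ᴴ * bsBlock θ N = 1 := by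
  have h : ((θ : ℂ) • bsMatrix N)ᴴ = -((θ : ℂ) • bsMatrix N) := by
    rw [Matrix.conjTranspose_smul, bsMatrix_conjTranspose]
    simp
  rw [bsBlock, ← Matrix.exp_conjTranspose, h, Matrix.exp_neg]
  exact Matrix.nonsing_inv_mul _ ((Matrix.isUnit_iff_isUnit_det _).1 (Matrix.isUnit_exp _))

theorem sum_norm_sq_mulVec {n : Type} [Fintype n] [DecidableEq n] (U : Matrix n n ℂ)
    (hU : Uᴴ * U = 1) (v : n → ℂ) : ∑ j, ‖(U *ᵥ v) j‖ ^ 2 = ∑ i, ‖v i‖ ^ 2 := by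
  have key : star (U *ᵥ v) ⬝ᵥ (U *ᵥ v) = star v ⬝ᵥ v := by
    rw [Matrix.star_mulVec, ← Matrix.dotProduct_mulVec, Matrix.mulVec_mulVec, hU,
      Matrix.one_mulVec]
  have conv : ∀ w : n → ℂ, star w ⬝ᵥ w = ((∑ j, ‖w j‖ ^ 2 : ℝ) : ℂ) := by
    intro w
    simp [dotProduct, Complex.conj_mul']
  rw [conv, conv] at key
  exact_mod_cast key

/-- Pairs of photon numbers, sorted by the total photon number. -/
def sectorEquiv : (Σ N : ℕ, Fin (N + 1)) ≃ ℕ × ℕ where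
  toFun x := ((x.2 : ℕ), x.1 - (x.2 : ℕ))
  invFun p := ⟨p.1 + p.2, ⟨p.1, Nat.lt_succ_of_le (Nat.le_add_right _ _)⟩⟩
  left_inv := by
    rintro ⟨N, i, hi⟩
    have h : i + (N - i) = N := by omega
    refine Sigma.ext h ?_
    simp only
    congr 1 <;> simp [h]
  right_inv := by
    rintro ⟨j, l⟩
    simp

theorem hasSum_sector {g : ℕ × ℕ → ℝ} (hg : ∀ p, 0 ≤ g p) {s : ℝ} :
    HasSum g s ↔ HasSum (fun N => ∑ i : Fin (N + 1), g ((i : ℕ), N - (i : ℕ))) s := by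
  rw [← sectorEquiv.hasSum_iff]
  constructor
  · intro h
    exact h.sigma fun N => hasSum_fintype _
  · intro h
    have hs : Summable (g ∘ sectorEquiv) := by
      refine (summable_sigma_of_nonneg (f := g ∘ sectorEquiv) (fun _ => hg _)).2 ?_
      refine ⟨fun N => (hasSum_fintype _).summable, ?_⟩
      simp only [tsum_fintype]
      exact h.summable
    have h2 := hs.hasSum.sigma fun N => hasSum_fintype _
    have : (∑' x, (g ∘ sectorEquiv) x) = s := h2.unique h
    rw [← this]
    exact hs.hasSum

theorem bsFun_sector (θ : ℝ) (ψ : ℕ × ℕ → ℂ) (N : ℕ) (i : Fin (N + 1)) :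
    bsFun θ ψ ((i : ℕ), N - (i : ℕ)) =
      (bsBlock θ N *ᵥ fun k => ψ ((k : ℕ), N - (k : ℕ))) i := by
  have aux : ∀ (M : ℕ) (_ : M = N) (hM : (i : ℕ) < M + 1),
      (bsBlock θ M *ᵥ fun k => ψ ((k : ℕ), M - (k : ℕ))) ⟨i, hM⟩ =
        (bsBlock θ N *ᵥ fun k => ψ ((k : ℕ), N - (k : ℕ))) i := by
    intro M h hM
    subst h
    rfl
  exact aux _ (by have := i.2; simp only; omega) _

theorem hasSum_bsFun (θ : ℝ) (ψ : ℕ × ℕ → ℂ) {s : ℝ} :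
    HasSum (fun p => ‖bsFun θ ψ p‖ ^ 2) s ↔ HasSum (fun p => ‖ψ p‖ ^ 2) s := by
  rw [hasSum_sector (fun _ => by positivity), hasSum_sector (fun _ => by positivity)]
  simp only [bsFun_sector, sum_norm_sq_mulVec _ (bsBlock_unitary θ _)]

theorem hasSum_norm_sq {ι : Type} (f : lp (fun _ : ι => ℂ) 2) :
    HasSum (fun i => ‖f i‖ ^ 2) (‖f‖ ^ 2) := by
  simpa using lp.hasSum_norm (p := 2) (by norm_num) f

theorem memℓp_two {ι : Type} {f : ι → ℂ} {s : ℝ} (h : HasSum (fun i => ‖f i‖ ^ 2) s) :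
    Memℓp f 2 :=
  memℓp_gen (by simpa using h.summable)

/-- The unitary `exp (θ (a₁ a₂† - a₁† a₂))` of two modes. -/
def bsRotation (θ : ℝ) : TwoMode →ₗᵢ[ℂ] TwoMode where
  toFun ψ := ⟨bsFun θ ψ, memℓp_two ((hasSum_bsFun θ ψ).2 (hasSum_norm_sq ψ))⟩
  map_add' ψ φ := by
    ext p
    exact congrFun (Matrix.mulVec_add (bsBlock θ (p.1 + p.2)) _ _) _
  map_smul' c ψ := by
    ext p
    exact congrFun (Matrix.mulVec_smul (bsBlock θ (p.1 + p.2)) c _) _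
  norm_map' ψ := by
    have h := (hasSum_norm_sq
      (⟨bsFun θ ψ, memℓp_two ((hasSum_bsFun θ ψ).2 (hasSum_norm_sq ψ))⟩ : TwoMode)).unique
      ((hasSum_bsFun θ ψ).2 (hasSum_norm_sq ψ))
    exact (pow_left_inj₀ (norm_nonneg _) (norm_nonneg _) two_ne_zero).1 h

/-- The beam splitter `B(T) = exp (arccos √T (a₁ a₂† - a₁† a₂))` with transmission
probability `T ∈ [0, 1]`. -/
def beamSplitter (T : ℝ) : TwoMode →L[ℂ] TwoMode :=
  (bsRotation (Real.arccos (√T))).toContinuousLinearMap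

/-! ### The loss channel -/

/-- The amplitudes of `φ ⊗ |l⟩`. -/
def attachFun (l : ℕ) (φ : ℕ → ℂ) : ℕ × ℕ → ℂ := fun p => if p.2 = l then φ p.1 else 0

theorem hasSum_attachFun (l : ℕ) (φ : ℕ → ℂ) {s : ℝ} :
    HasSum (fun p => ‖attachFun l φ p‖ ^ 2) s ↔ HasSum (fun n => ‖φ n‖ ^ 2) s := by
  have hinj : Function.Injective fun n : ℕ => (n, l) := fun a b h => (Prod.mk.inj h).1
  rw [← hinj.hasSum_iff]
  · simp [Function.comp_def, attachFun]
  · rintro ⟨a, b⟩ h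
    have : b ≠ l := fun hb => h ⟨a, by rw [hb]⟩
    simp [attachFun, this]

/-- The isometry `φ ↦ φ ⊗ |l⟩` that adds a second mode with exactly `l` photons. -/
def attach (l : ℕ) : OneMode →ₗᵢ[ℂ] TwoMode where
  toFun φ := ⟨attachFun l φ, memℓp_two ((hasSum_attachFun l φ).2 (hasSum_norm_sq φ))⟩
  map_add' φ χ := by
    ext p
    change attachFun l (fun n => φ n + χ n) p = attachFun l φ p + attachFun l χ p
    by_cases h : p.2 = l <;> simp [attachFun, h]
  map_smul' c φ := by
    ext p
    by_cases h : p.2 = l <;> simp [attachFun, h]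
  norm_map' φ := by
    have h := (hasSum_norm_sq
      (⟨attachFun l φ, memℓp_two ((hasSum_attachFun l φ).2 (hasSum_norm_sq φ))⟩ :
        TwoMode)).unique ((hasSum_attachFun l φ).2 (hasSum_norm_sq φ))
    exact (pow_left_inj₀ (norm_nonneg _) (norm_nonneg _) two_ne_zero).1 h

/-- The isometry `φ ↦ φ ⊗ |l⟩` as a bounded operator. -/
def attachL (l : ℕ) : OneMode →L[ℂ] TwoMode := (attach l).toContinuousLinearMap

/-- The two-mode operator `ρ ⊗ |0⟩⟨0|`. -/
def tensorVacuum (ρ : OneMode →L[ℂ] OneMode) : TwoMode →L[ℂ] TwoMode :=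
  attachL 0 ∘L ρ ∘L ContinuousLinearMap.adjoint (attachL 0)

/-- The partial trace `Tr₂[A] = ∑ₗ (1 ⊗ ⟨l|) A (1 ⊗ |l⟩)` over the second mode. For a trace-class
`A` the series converges in norm (even in trace norm). -/
def partialTrace2 (A : TwoMode →L[ℂ] TwoMode) : OneMode →L[ℂ] OneMode :=
  ∑' l, ContinuousLinearMap.adjoint (attachL l) ∘L A ∘L attachL l

/-- The state `ρ_T = Tr₂[B(T) (ρ ⊗ |0⟩⟨0|) B(T)†]`: the state `ρ` after loss with transmission
probability `T`. -/
def loss (T : ℝ) (ρ : OneMode →L[ℂ] OneMode) : OneMode →L[ℂ] OneMode :=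
  partialTrace2
    (beamSplitter T ∘L tensorVacuum ρ ∘L ContinuousLinearMap.adjoint (beamSplitter T))

end BosonicLoss

end

/-!
The overlap `Tr[σ_T ρ_T]` is the expectation of the swap operator in `ρ_T ⊗ σ_T`. The swap is the
parity `(-1) ^ n₋` of the photon number `n₋` in the antisymmetric output of a balanced beam
splitter, and equal loss in both modes commutes with that beam splitter. In the Heisenberg picture
the loss sends `(-1) ^ n₋` to `(1 - 2T) ^ n₋`: a photon contributes `-1` if it survives and `1` if
it is lost. Hence the coefficient of `(1 - 2T) ^ m` is the probability `antisymmProb` of finding `m`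
photons in the antisymmetric output when `ρ ⊗ σ` enters, which is nonnegative.

The argument below carries this out with matrix elements. The last columns of the sector blocks of
the beam splitter are binomial amplitudes (`bsBlock_apply_last`), which gives the Kraus operators
and the matrix elements of `ρ_T` (`IsState.hasSum_entry_loss`). The overlap becomes an absolutely
convergent sum over four photon numbers (`hasSum_overlapTerm`), in which the terms are sorted by
the total photon number `N`. On the sector `N`, the two ways of expanding
`(T (u + v) + (1 - T) (u v + 1)) ^ N = 2⁻ᴺ ((1 + u) (1 + v) + (1 - 2T) (1 - u) (1 - v)) ^ N`
in `ℂ[u] ⊗ ℂ[v]` (`tmul_expand_transmitted`, `tmul_expand_modes`), paired with the matrix of `ρ ⊗ σ`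
on that sector, give the overlap on one side and a polynomial in `1 - 2T` on the other
(`sum_overlapTerm_sector`). Its coefficients are nonnegative because a matrix of `ρ` times,
entrywise, a matrix of `σ` is positive semidefinite by the Schur product theorem
(`pairing_sectorForm_nonneg`). Monotonicity and convexity hold for each power of `1 - 2T`.
-/

open scoped Matrix InnerProductSpace ENNReal

noncomputable section

namespace BosonicLoss

open Finset.HasAntidiagonal (antidiagonal mem_antidiagonal)

/-! ### The beam splitter acting on the vacuum in the second mode -/

theorem bsMatrix_apply (N : ℕ) (j i : Fin (N + 1)) :
    bsMatrix N j i =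
      (√((j : ℝ) + 1) * √((N - j : ℕ) : ℝ) : ℝ) * (if (i : ℕ) = j + 1 then 1 else 0) -
        (√(j : ℝ) * √(((N - j : ℕ) : ℝ) + 1) : ℝ) * (if (i : ℕ) = j - 1 then 1 else 0) := by
  obtain ⟨j, hj⟩ := j
  obtain ⟨i, hi⟩ := i
  simp only [bsMatrix, Matrix.of_apply, bsGenerator, ann1, ann2, cre1, cre2, Pi.sub_apply,
    Pi.single_apply, Prod.mk.injEq]
  congr 1
  · rcases Nat.eq_zero_or_pos (N - j) with h | h
    · simp [h]
    · have : (j + 1 = i ∧ N - j - 1 = N - i) ↔ i = j + 1 := by omega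
      simp only [this]
      push_cast
      ring
  · rcases Nat.eq_zero_or_pos j with h | h
    · simp [h]
    · have : (j - 1 = i ∧ N - j + 1 = N - i) ↔ i = j - 1 := by omega
      simp only [this]
      push_cast
      ring

/-- The generator couples neighbouring photon numbers only. The values `f (N + 1)` and `f (0 - 1)`
that lie outside the sector come with the coefficient `0`. -/
theorem bsMatrix_mulVec (N : ℕ) (f : ℕ → ℂ) (j : Fin (N + 1)) :
    (bsMatrix N *ᵥ fun i => f i) j =
      (√((j : ℝ) + 1) * √((N - j : ℕ) : ℝ) : ℝ) * f (j + 1) -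
        (√(j : ℝ) * √(((N - j : ℕ) : ℝ) + 1) : ℝ) * f (j - 1) := by
  simp only [Matrix.mulVec, dotProduct, bsMatrix_apply]
  rw [Fin.sum_univ_eq_sum_range (fun i : ℕ =>
    ((√((j : ℝ) + 1) * √((N - j : ℕ) : ℝ) : ℝ) * (if i = (j : ℕ) + 1 then (1 : ℂ) else 0) -
        (√(j : ℝ) * √(((N - j : ℕ) : ℝ) + 1) : ℝ) *
          (if i = (j : ℕ) - 1 then (1 : ℂ) else 0)) * f i) (N + 1)]
  simp only [sub_mul, Finset.sum_sub_distrib, mul_assoc, ite_mul, one_mul, zero_mul, mul_ite,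
    mul_zero, Finset.sum_ite_eq', Finset.mem_range]
  have hj := j.2
  congr 1
  · split_ifs with h
    · rfl
    · have : N - (j : ℕ) = 0 := by omega
      simp [this]
  · rw [if_pos (by omega)]

/-- The amplitudes, in the sector with `N` photons, of the state obtained by sending `N` photons
into the first port of a beam splitter of angle `θ`. -/
def binomialAmp (N : ℕ) (θ : ℝ) (j : ℕ) : ℝ :=
  √(N.choose j : ℝ) * (Real.cos θ ^ j * Real.sin θ ^ (N - j))

theorem hasDerivAt_binomialAmp (N : ℕ) (θ : ℝ) {j : ℕ} (hj : j ≤ N) :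
    HasDerivAt (fun t => binomialAmp N t j)
      (√((j : ℝ) + 1) * √((N - j : ℕ) : ℝ) * binomialAmp N θ (j + 1) -
        √(j : ℝ) * √(((N - j : ℕ) : ℝ) + 1) * binomialAmp N θ (j - 1)) θ := by
  obtain ⟨l, rfl⟩ := Nat.exists_eq_add_of_le hj
  have h := (((Real.hasDerivAt_cos θ).pow j).mul ((Real.hasDerivAt_sin θ).pow l)).const_mul
    (√((j + l).choose j : ℝ))
  have e0 : j + l - j = l := by omega
  have e1 : √((j : ℝ) + 1) * √(l : ℝ) * √((j + l).choose (j + 1) : ℝ) =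
      l * √((j + l).choose j : ℝ) := by
    have := Nat.choose_succ_right_eq (j + l) j
    rw [e0] at this
    have h2 : (((j + l).choose (j + 1) : ℕ) : ℝ) * (j + 1) = ((j + l).choose j : ℕ) * l := by
      exact_mod_cast this
    rw [← Real.sqrt_mul (by positivity), ← Real.sqrt_mul (by positivity),
      show ((j : ℝ) + 1) * l * ((j + l).choose (j + 1) : ℝ) =
        (l : ℝ) ^ 2 * ((j + l).choose j : ℝ) by linear_combination (l : ℝ) * h2,
      Real.sqrt_mul (by positivity), Real.sqrt_sq (by positivity)]
  have e2 : √(j : ℝ) * √((l : ℝ) + 1) * √((j + l).choose (j - 1) : ℝ) =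
      j * √((j + l).choose j : ℝ) := by
    rcases j with _ | i
    · simp
    have := Nat.choose_succ_right_eq (i + 1 + l) i
    rw [show i + 1 + l - i = l + 1 by omega] at this
    have h2 : (((i + 1 + l).choose (i + 1) : ℕ) : ℝ) * (i + 1) =
        ((i + 1 + l).choose i : ℕ) * (l + 1) := by
      exact_mod_cast this
    rw [Nat.add_sub_cancel, ← Real.sqrt_mul (by positivity), ← Real.sqrt_mul (by positivity),
      show ((i + 1 : ℕ) : ℝ) * ((l : ℝ) + 1) * ((i + 1 + l).choose i : ℝ) =
        ((i + 1 : ℕ) : ℝ) ^ 2 * ((i + 1 + l).choose (i + 1) : ℝ) by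
          push_cast; linear_combination -((i : ℝ) + 1) * h2,
      Real.sqrt_mul (by positivity), Real.sqrt_sq (by positivity)]
  simp only [binomialAmp, e0]
  refine HasDerivAt.congr_deriv h (Eq.symm ?_)
  have x1 : √((j : ℝ) + 1) * √(l : ℝ) * (√((j + l).choose (j + 1) : ℝ) *
      (Real.cos θ ^ (j + 1) * Real.sin θ ^ (j + l - (j + 1)))) =
      √((j + l).choose j : ℝ) * (Real.cos θ ^ j * (l * Real.sin θ ^ (l - 1) * Real.cos θ)) := by
    rw [show j + l - (j + 1) = l - 1 by omega, pow_succ]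
    linear_combination (Real.cos θ ^ j * Real.cos θ * Real.sin θ ^ (l - 1)) * e1
  have x2 : √(j : ℝ) * √((l : ℝ) + 1) * (√((j + l).choose (j - 1) : ℝ) *
      (Real.cos θ ^ (j - 1) * Real.sin θ ^ (j + l - (j - 1)))) =
      √((j + l).choose j : ℝ) * (j * Real.cos θ ^ (j - 1) * Real.sin θ * Real.sin θ ^ l) := by
    rcases j with _ | i
    · simp
    rw [show i + 1 + l - (i + 1 - 1) = l + 1 by omega, pow_succ]
    linear_combination (Real.cos θ ^ (i + 1 - 1) * (Real.sin θ ^ l * Real.sin θ)) * e2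
  rw [x1, x2]
  simp only [Pi.pow_apply]
  ring

theorem bsBlock_mul_exp_neg (θ : ℝ) (N : ℕ) :
    bsBlock θ N * NormedSpace.exp (θ • (-bsMatrix N)) = 1 := by
  rw [bsBlock, Complex.coe_smul, smul_neg, Matrix.exp_neg]
  exact Matrix.mul_nonsing_inv _
    ((Matrix.isUnit_iff_isUnit_det _).1 (Matrix.isUnit_exp (θ • bsMatrix N)))

open scoped Matrix.Norms.Operator in
/-- The last column of a sector block of the beam splitter: sending all `N` photons into the first
port splits them binomially. The binomial amplitudes solve the differential equation
`f' = bsMatrix N f` with the same initial value. -/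
theorem bsBlock_apply_last (θ : ℝ) (N : ℕ) (j : Fin (N + 1)) :
    bsBlock θ N j (Fin.last N) = (binomialAmp N θ j : ℂ) := by
  -- All columns of `F t` are the vector of binomial amplitudes, so that `F' = bsMatrix N * F` and
  -- `exp (-t bsMatrix N) * F t` is constant.
  set F : ℝ → Matrix (Fin (N + 1)) (Fin (N + 1)) ℂ := fun t =>
    ∑ i : Fin (N + 1), binomialAmp N t i •
      (Matrix.of fun a _ => if a = i then 1 else 0 : Matrix (Fin (N + 1)) (Fin (N + 1)) ℂ)
    with hF
  have hFa : ∀ t a b, F t a b = (binomialAmp N t a : ℂ) := by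
    intro t a b
    simp [hF, Matrix.sum_apply]
  have hFd : ∀ t, HasDerivAt F (bsMatrix N * F t) t := by
    intro t
    have h := HasDerivAt.fun_sum fun (i : Fin (N + 1)) (_ : i ∈ Finset.univ) =>
      (hasDerivAt_binomialAmp N t (Nat.lt_succ_iff.1 i.2)).smul_const
        (Matrix.of fun a _ => if a = i then 1 else 0 : Matrix (Fin (N + 1)) (Fin (N + 1)) ℂ)
    refine h.congr_deriv (Eq.symm ?_)
    ext a b
    have h1 : (bsMatrix N * F t) a b = (bsMatrix N *ᵥ fun i => (binomialAmp N t i : ℂ)) a := by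
      simp [Matrix.mul_apply, Matrix.mulVec, dotProduct, hFa]
    rw [h1, bsMatrix_mulVec N (fun i => (binomialAmp N t i : ℂ)) a]
    simp [Matrix.sum_apply]
  set E : ℝ → Matrix (Fin (N + 1)) (Fin (N + 1)) ℂ := fun t =>
    NormedSpace.exp (t • (-bsMatrix N)) * F t with hE
  have hEd : ∀ t, HasDerivAt E 0 t := by
    intro t
    have h := (hasDerivAt_exp_smul_const (𝕂 := ℝ) (-bsMatrix N) t).mul (hFd t)
    refine h.congr_deriv ?_
    rw [mul_neg, neg_mul, mul_assoc, neg_add_cancel]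
  have hc : E θ = E 0 := is_const_of_deriv_eq_zero (fun t => (hEd t).differentiableAt)
    (fun t => (hEd t).deriv) θ 0
  have hB : bsBlock θ N * F 0 = F θ := by
    have h0 : E 0 = F 0 := by simp [hE, NormedSpace.exp_zero]
    rw [← h0, ← hc]
    change bsBlock θ N * (NormedSpace.exp (θ • (-bsMatrix N)) * F θ) = F θ
    rw [← mul_assoc, bsBlock_mul_exp_neg, one_mul]
  have := congrFun (congrFun hB j) j
  rw [hFa, Matrix.mul_apply] at this
  rw [← this, Finset.sum_eq_single (Fin.last N)]
  · simp [hFa, binomialAmp]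
  · intro i _ hi
    have hlt : (i : ℕ) < N := Fin.val_lt_last hi
    simp [hFa, binomialAmp, Nat.sub_ne_zero_of_lt hlt]
  · simp

/-! ### Matrix elements of positive operators -/

/-- The matrix element `⟨j| A |k⟩` in the Fock basis. -/
def entry (A : OneMode →L[ℂ] OneMode) (j k : ℕ) : ℂ := ⟪fock j, A (fock k)⟫_ℂ

theorem inner_fock (n : ℕ) (φ : OneMode) : ⟪fock n, φ⟫_ℂ = φ n := by
  rw [fock, lp.inner_single_left]
  simp

theorem entry_eq_apply (A : OneMode →L[ℂ] OneMode) (j k : ℕ) : entry A j k = A (fock k) j :=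
  inner_fock j _

theorem fock_apply (n m : ℕ) : fock n m = if m = n then 1 else 0 := by
  rw [fock, lp.single_apply, Pi.single_apply]

theorem conj_entry {A : OneMode →L[ℂ] OneMode} (hA : A.IsPositive) (j k : ℕ) :
    (starRingEnd ℂ) (entry A j k) = entry A k j := by
  rw [entry, entry, inner_conj_symm]
  exact hA.isSymmetric _ _

open scoped ComplexOrder in
theorem posSemidef_entry {A : OneMode →L[ℂ] OneMode} (hA : A.IsPositive) {ι : Type} [Fintype ι]
    (f : ι → ℕ) : (Matrix.of fun a b => entry A (f a) (f b)).PosSemidef := by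
  refine Matrix.PosSemidef.of_dotProduct_mulVec_nonneg ?_ fun x => ?_
  · ext a b
    simp only [Matrix.conjTranspose_apply, Matrix.of_apply]
    exact conj_entry hA _ _
  · have h := hA.inner_nonneg_right (∑ a, x a • fock (f a))
    simp only [map_sum, map_smul, sum_inner, inner_sum, inner_smul_left, inner_smul_right] at h
    simp only [Finset.mul_sum] at h
    rw [Finset.sum_comm] at h
    simpa [dotProduct, Matrix.mulVec, Finset.mul_sum, entry, mul_comm, mul_left_comm] using h

theorem entry_self_re_nonneg {A : OneMode →L[ℂ] OneMode} (hA : A.IsPositive) (n : ℕ) :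
    0 ≤ (entry A n n).re :=
  hA.re_inner_nonneg_right (fock n)

theorem ofReal_re_entry_self {A : OneMode →L[ℂ] OneMode} (hA : A.IsPositive) (n : ℕ) :
    (((entry A n n).re : ℝ) : ℂ) = entry A n n :=
  Complex.conj_eq_iff_re.1 (conj_entry hA n n)

open scoped ComplexOrder in
/-- The Cauchy-Schwarz inequality for a positive operator, as the nonnegativity of a `2 × 2`
principal minor. -/
theorem norm_entry_sq_le {A : OneMode →L[ℂ] OneMode} (hA : A.IsPositive) (j k : ℕ) :
    ‖entry A j k‖ ^ 2 ≤ (entry A j j).re * (entry A k k).re := by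
  have h := (posSemidef_entry hA ![j, k]).det_nonneg
  rw [Matrix.det_fin_two] at h
  simp only [Matrix.of_apply, Matrix.cons_val_zero, Matrix.cons_val_one] at h
  rw [← conj_entry hA j k, Complex.mul_conj', ← ofReal_re_entry_self hA j,
    ← ofReal_re_entry_self hA k] at h
  have h2 : (0 : ℝ) ≤ (entry A j j).re * (entry A k k).re - ‖entry A j k‖ ^ 2 := by
    exact_mod_cast h
  linarith

/-- The operator norm of a positive operator is at most its trace. -/
theorem opNorm_le_of_hasSum {A : OneMode →L[ℂ] OneMode} (hA : A.IsPositive) {t : ℝ}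
    (ht : HasSum (fun n => (entry A n n).re) t) : ‖A‖ ≤ t := by
  have h0 : ∀ n, 0 ≤ (entry A n n).re := entry_self_re_nonneg hA
  have ht0 : 0 ≤ t := ht.nonneg h0
  have hcol : ∀ k, ‖A (fock k)‖ ≤ √(t * (entry A k k).re) := by
    intro k
    refine Real.le_sqrt_of_sq_le ?_
    refine hasSum_le (fun j => ?_) (hasSum_norm_sq (A (fock k))) (ht.mul_right _)
    rw [← entry_eq_apply]
    exact norm_entry_sq_le hA j k
  refine A.opNorm_le_bound ht0 fun x => ?_
  have hx : HasSum (fun i => x i • fock i) x := by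
    have := lp.hasSum_single (p := 2) (by norm_num) x
    convert! this using 2 with i
    ext m
    simp [fock_apply, Pi.single_apply]
  have hAx : HasSum (fun i => x i • A (fock i)) (A x) := by
    simpa using hx.mapL A
  refine le_of_tendsto hAx.norm (Filter.Eventually.of_forall fun s => ?_)
  calc ‖∑ i ∈ s, x i • A (fock i)‖ ≤ ∑ i ∈ s, ‖x i‖ * √(t * (entry A i i).re) := by
        refine (norm_sum_le _ _).trans (Finset.sum_le_sum fun i _ => ?_)
        rw [norm_smul]
        exact mul_le_mul_of_nonneg_left (hcol i) (norm_nonneg _)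
    _ = ∑ i ∈ s, √(‖x i‖ ^ 2) * √(t * (entry A i i).re) := by
        simp
    _ ≤ √(∑ i ∈ s, ‖x i‖ ^ 2) * √(∑ i ∈ s, t * (entry A i i).re) :=
        Real.sum_sqrt_mul_sqrt_le s (fun i => by positivity) fun i => mul_nonneg ht0 (h0 i)
    _ ≤ √(‖x‖ ^ 2) * √(t ^ 2) := by
        gcongr
        · exact sum_le_hasSum s (fun i _ => by positivity) (hasSum_norm_sq x)
        · rw [← Finset.mul_sum, sq]
          exact mul_le_mul_of_nonneg_left (sum_le_hasSum s (fun i _ => h0 i) ht) ht0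
    _ = t * ‖x‖ := by
        rw [Real.sqrt_sq (norm_nonneg _), Real.sqrt_sq ht0, mul_comm]

/-! ### Binomial loss amplitudes -/

/-- The amplitude for `j` out of `j + l` photons to be transmitted and `l` to be lost. -/
def lossAmp (T : ℝ) (j l : ℕ) : ℝ := √((j + l).choose j : ℝ) * (√T ^ j * √(1 - T) ^ l)

theorem lossAmp_sq {T : ℝ} (hT : T ∈ Set.Icc (0 : ℝ) 1) (j l : ℕ) :
    lossAmp T j l ^ 2 = (j + l).choose j * (T ^ j * (1 - T) ^ l) := by
  rw [lossAmp, mul_pow, mul_pow, Real.sq_sqrt (by positivity), ← pow_mul, ← pow_mul, mul_comm j,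
    mul_comm l, pow_mul, pow_mul, Real.sq_sqrt hT.1, Real.sq_sqrt (by linarith [hT.2])]

theorem sum_antidiagonal_lossAmp_sq {T : ℝ} (hT : T ∈ Set.Icc (0 : ℝ) 1) (N : ℕ) :
    ∑ p ∈ antidiagonal N, lossAmp T p.1 p.2 ^ 2 = 1 := by
  have h := (Commute.all T (1 - T)).add_pow' N
  rw [add_sub_cancel, one_pow] at h
  rw [h]
  refine Finset.sum_congr rfl fun p hp => ?_
  rw [lossAmp_sq hT, mem_antidiagonal.1 hp, nsmul_eq_mul]

/-- Sums of nonnegative terms over pairs, sorted by the total. -/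
theorem summable_prod_iff_antidiagonal {f : ℕ × ℕ → ℝ} (hf : ∀ p, 0 ≤ f p) :
    Summable f ↔ Summable fun N => ∑ p ∈ antidiagonal N, f p := by
  rw [← Finset.HasAntidiagonal.sigmaAntidiagonalEquivProd.summable_iff,
    summable_sigma_of_nonneg
      (f := f ∘ Finset.HasAntidiagonal.sigmaAntidiagonalEquivProd) (fun _ => hf _)]
  have h : ∀ N, ∑' p : antidiagonal N,
      (f ∘ Finset.HasAntidiagonal.sigmaAntidiagonalEquivProd) ⟨N, p⟩ =
        ∑ p ∈ antidiagonal N, f p := by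
    intro N
    rw [tsum_fintype, ← Finset.sum_coe_sort (antidiagonal N) f]
    rfl
  simp only [h]
  exact and_iff_right fun N => (hasSum_fintype _).summable

theorem summable_lossAmp_sq_mul {T : ℝ} (hT : T ∈ Set.Icc (0 : ℝ) 1) {d : ℕ → ℝ}
    (hd : ∀ n, 0 ≤ d n) (hs : Summable d) :
    Summable fun p : ℕ × ℕ => lossAmp T p.1 p.2 ^ 2 * d (p.1 + p.2) := by
  rw [summable_prod_iff_antidiagonal fun p => mul_nonneg (sq_nonneg _) (hd _)]
  refine hs.congr fun N => ?_
  rw [Finset.sum_congr rfl fun p hp => by rw [mem_antidiagonal.1 hp],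
    ← Finset.sum_mul, sum_antidiagonal_lossAmp_sq hT, one_mul]

/-! ### Kraus operators and matrix elements of the loss channel -/

/-- The Kraus operator of the loss channel for the loss of `l` photons. -/
def kraus (T : ℝ) (l : ℕ) : OneMode →L[ℂ] OneMode :=
  ContinuousLinearMap.adjoint (attachL l) ∘L beamSplitter T ∘L attachL 0

theorem loss_eq_tsum_kraus (T : ℝ) (ρ : OneMode →L[ℂ] OneMode) :
    loss T ρ = ∑' l, kraus T l ∘L ρ ∘L ContinuousLinearMap.adjoint (kraus T l) := by
  unfold loss partialTrace2
  refine tsum_congr fun l => ?_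
  simp only [kraus, tensorVacuum, ContinuousLinearMap.adjoint_comp,
    ContinuousLinearMap.adjoint_adjoint, ContinuousLinearMap.comp_assoc]

theorem attachL_fock (l j : ℕ) : attachL l (fock j) = lp.single 2 (j, l) (1 : ℂ) := by
  ext ⟨a, b⟩
  change attachFun l (fock j) (a, b) = _
  rw [lp.single_apply, Pi.single_apply, attachFun, fock_apply]
  simp only [Prod.mk.injEq]
  split_ifs <;> simp_all

theorem adjoint_attachL_apply (l : ℕ) (ψ : TwoMode) (j : ℕ) :
    ContinuousLinearMap.adjoint (attachL l) ψ j = ψ (j, l) := by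
  rw [← inner_fock, ContinuousLinearMap.adjoint_inner_right, attachL_fock, lp.inner_single_left]
  simp

theorem kraus_apply {T : ℝ} (hT : T ∈ Set.Icc (0 : ℝ) 1) (l : ℕ) (φ : OneMode) (j : ℕ) :
    kraus T l φ j = lossAmp T j l * φ (j + l) := by
  have hs : √T ∈ Set.Icc (-1 : ℝ) 1 :=
    ⟨by linarith [Real.sqrt_nonneg T], Real.sqrt_le_one.2 hT.2⟩
  have hl : (kraus T l φ) j = bsFun (Real.arccos (√T)) (attachFun 0 φ) (j, l) :=
    adjoint_attachL_apply l _ j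
  rw [hl]
  simp only [bsFun, Matrix.mulVec, dotProduct, attachFun]
  rw [Finset.sum_eq_single (Fin.last (j + l))]
  · rw [bsBlock_apply_last]
    simp [binomialAmp, lossAmp, Real.cos_arccos hs.1 hs.2, Real.sin_arccos, Real.sq_sqrt hT.1]
  · intro i _ hi
    have : (i : ℕ) < j + l := Fin.val_lt_last hi
    rw [if_neg (by omega), mul_zero]
  · simp

theorem adjoint_kraus_fock {T : ℝ} (hT : T ∈ Set.Icc (0 : ℝ) 1) (l j : ℕ) :
    ContinuousLinearMap.adjoint (kraus T l) (fock j) = (lossAmp T j l : ℂ) • fock (j + l) := by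
  refine ext_inner_right ℂ fun φ => ?_
  rw [ContinuousLinearMap.adjoint_inner_left, inner_fock, inner_smul_left, inner_fock,
    kraus_apply hT, Complex.conj_ofReal]

theorem entry_kraus {T : ℝ} (hT : T ∈ Set.Icc (0 : ℝ) 1) (ρ : OneMode →L[ℂ] OneMode)
    (l j k : ℕ) :
    entry (kraus T l ∘L ρ ∘L ContinuousLinearMap.adjoint (kraus T l)) j k =
      (lossAmp T j l * lossAmp T k l : ℝ) * entry ρ (j + l) (k + l) := by
  rw [entry, ContinuousLinearMap.comp_apply, ContinuousLinearMap.comp_apply,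
    ← ContinuousLinearMap.adjoint_inner_left, adjoint_kraus_fock hT, adjoint_kraus_fock hT,
    map_smul, inner_smul_left, inner_smul_right, Complex.conj_ofReal, entry]
  push_cast
  ring

/-- The diagonal of a state in the Fock basis: its photon number distribution. -/
def photonDist (ρ : OneMode →L[ℂ] OneMode) (n : ℕ) : ℝ := (entry ρ n n).re

theorem IsState.photonDist_nonneg {ρ : OneMode →L[ℂ] OneMode} (hρ : IsState ρ) (n : ℕ) :
    0 ≤ photonDist ρ n := entry_self_re_nonneg hρ.isPositive n

theorem IsState.summable_photonDist {ρ : OneMode →L[ℂ] OneMode} (hρ : IsState ρ) :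
    Summable (photonDist ρ) :=
  (Complex.hasSum_re hρ.hasSum_trace).summable

theorem IsState.summable_lossAmp_sq {ρ : OneMode →L[ℂ] OneMode} (hρ : IsState ρ) {T : ℝ}
    (hT : T ∈ Set.Icc (0 : ℝ) 1) :
    Summable fun p : ℕ × ℕ => lossAmp T p.1 p.2 ^ 2 * photonDist ρ (p.1 + p.2) :=
  summable_lossAmp_sq_mul hT hρ.photonDist_nonneg hρ.summable_photonDist

/-- The series of Kraus terms converges in operator norm, by comparison with their traces. -/
theorem IsState.summable_kraus {ρ : OneMode →L[ℂ] OneMode} (hρ : IsState ρ) {T : ℝ}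
    (hT : T ∈ Set.Icc (0 : ℝ) 1) :
    Summable fun l => kraus T l ∘L ρ ∘L ContinuousLinearMap.adjoint (kraus T l) := by
  have h := (hρ.summable_lossAmp_sq hT).prod_symm
  refine Summable.of_norm_bounded h.prod fun l => ?_
  refine opNorm_le_of_hasSum (hρ.isPositive.conj_adjoint _) ?_
  refine (h.prod_factor l).hasSum.congr_fun fun j => ?_
  rw [entry_kraus hT, Complex.re_ofReal_mul, sq, photonDist]
  rfl

theorem IsState.hasSum_entry_loss {ρ : OneMode →L[ℂ] OneMode} (hρ : IsState ρ) {T : ℝ}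
    (hT : T ∈ Set.Icc (0 : ℝ) 1) (j k : ℕ) :
    HasSum (fun l => ((lossAmp T j l * lossAmp T k l : ℝ) : ℂ) * entry ρ (j + l) (k + l))
      (entry (loss T ρ) j k) := by
  have h := (hρ.summable_kraus hT).hasSum
  rw [← loss_eq_tsum_kraus] at h
  have h2 := (h.mapL (ContinuousLinearMap.apply ℂ OneMode (fock k))).mapL (innerSL ℂ (fock j))
  simp only [← entry_kraus hT]
  exact h2

theorem IsState.isSelfAdjoint_loss {ρ : OneMode →L[ℂ] OneMode} (hρ : IsState ρ) (T : ℝ) :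
    ContinuousLinearMap.adjoint (loss T ρ) = loss T ρ := by
  rw [loss_eq_tsum_kraus, ← ContinuousLinearMap.star_eq_adjoint, tsum_star]
  refine tsum_congr fun l => ?_
  exact (hρ.isPositive.conj_adjoint (kraus T l)).isSelfAdjoint

/-! ### The overlap as a sum over four photon numbers -/

/-- The summand of the overlap `Tr[σ_T† ρ_T]` with index `((j, k), (l, l'))`: the matrix element
`(k, j)` of `ρ_T` meets the matrix element `(j, k)` of `σ_T`, and `l`, `l'` are the numbers of
photons lost from `ρ` and `σ`. -/
def overlapTerm (ρ σ : OneMode →L[ℂ] OneMode) (T : ℝ) (x : (ℕ × ℕ) × (ℕ × ℕ)) : ℂ :=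
  ((lossAmp T x.1.2 x.2.1 * lossAmp T x.1.1 x.2.1 *
      (lossAmp T x.1.1 x.2.2 * lossAmp T x.1.2 x.2.2) : ℝ) : ℂ) *
    (entry ρ (x.1.2 + x.2.1) (x.1.1 + x.2.1) * entry σ (x.1.1 + x.2.2) (x.1.2 + x.2.2))

/-- Termwise bound from `|A_jk|² ≤ A_jj A_kk` and the inequality of arithmetic and geometric means;
its right-hand side is summable over all four indices. -/
theorem norm_overlapTerm_le {ρ σ : OneMode →L[ℂ] OneMode} (hρ : IsState ρ) (hσ : IsState σ)
    (T : ℝ) (j k l l' : ℕ) :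
    ‖overlapTerm ρ σ T ((j, k), (l, l'))‖ ≤
      (lossAmp T j l ^ 2 * photonDist ρ (j + l) * (lossAmp T k l' ^ 2 * photonDist σ (k + l')) +
        lossAmp T k l ^ 2 * photonDist ρ (k + l) *
          (lossAmp T j l' ^ 2 * photonDist σ (j + l'))) / 2 := by
  have h1 := norm_entry_sq_le hρ.isPositive (k + l) (j + l)
  have h2 := norm_entry_sq_le hσ.isPositive (j + l') (k + l')
  have d1 := hρ.photonDist_nonneg (j + l)
  have d2 := hρ.photonDist_nonneg (k + l)
  have d3 := hσ.photonDist_nonneg (j + l')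
  have d4 := hσ.photonDist_nonneg (k + l')
  simp only [← photonDist.eq_1] at h1 h2
  refine (pow_le_pow_iff_left₀ (norm_nonneg _) (by positivity) two_ne_zero).1 ?_
  simp only [overlapTerm, norm_mul, Complex.norm_real, Real.norm_eq_abs, mul_pow, sq_abs]
  calc _ ≤ lossAmp T k l ^ 2 * lossAmp T j l ^ 2 * (lossAmp T j l' ^ 2 * lossAmp T k l' ^ 2) *
        ((photonDist ρ (k + l) * photonDist ρ (j + l)) *
          (photonDist σ (j + l') * photonDist σ (k + l'))) := by gcongr
    _ = (lossAmp T j l ^ 2 * photonDist ρ (j + l) *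
          (lossAmp T k l' ^ 2 * photonDist σ (k + l'))) *
        (lossAmp T k l ^ 2 * photonDist ρ (k + l) *
          (lossAmp T j l' ^ 2 * photonDist σ (j + l'))) := by ring
    _ ≤ _ := by
        generalize lossAmp T j l ^ 2 * photonDist ρ (j + l) *
          (lossAmp T k l' ^ 2 * photonDist σ (k + l')) = a
        generalize lossAmp T k l ^ 2 * photonDist ρ (k + l) *
          (lossAmp T j l' ^ 2 * photonDist σ (j + l')) = b
        linarith [sq_nonneg (a - b), show ((a + b) / 2) ^ 2 - a * b = (a - b) ^ 2 / 4 by ring]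

theorem summable_overlapTerm {ρ σ : OneMode →L[ℂ] OneMode} (hρ : IsState ρ) (hσ : IsState σ)
    {T : ℝ} (hT : T ∈ Set.Icc (0 : ℝ) 1) : Summable (overlapTerm ρ σ T) := by
  have h := (hρ.summable_lossAmp_sq hT).mul_of_nonneg (hσ.summable_lossAmp_sq hT)
    (fun p => mul_nonneg (sq_nonneg _) (hρ.photonDist_nonneg _))
    (fun p => mul_nonneg (sq_nonneg _) (hσ.photonDist_nonneg _))
  have h1 := (Equiv.prodProdProdComm ℕ ℕ ℕ ℕ).summable_iff.2 h
  have h2 := ((Equiv.prodComm ℕ ℕ).prodCongr (Equiv.refl (ℕ × ℕ))).summable_iff.2 h1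
  refine Summable.of_norm_bounded ((h1.add h2).div_const 2) ?_
  rintro ⟨⟨j, k⟩, ⟨l, l'⟩⟩
  exact norm_overlapTerm_le hρ hσ T j k l l'

theorem hsInner_eq_tsum (A B : OneMode →L[ℂ] OneMode) :
    hsInner A B = ∑' j, ∑' k, (starRingEnd ℂ) (entry A k j) * entry B k j := by
  unfold hsInner trace
  refine tsum_congr fun j => ?_
  rw [ContinuousLinearMap.comp_apply, ContinuousLinearMap.adjoint_inner_right,
    lp.inner_eq_tsum]
  refine tsum_congr fun k => ?_
  rw [entry_eq_apply, entry_eq_apply]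
  simp [mul_comm]

theorem hasSum_overlapTerm {ρ σ : OneMode →L[ℂ] OneMode} (hρ : IsState ρ) (hσ : IsState σ)
    {T : ℝ} (hT : T ∈ Set.Icc (0 : ℝ) 1) :
    HasSum (overlapTerm ρ σ T) (hsInner (loss T σ) (loss T ρ)) := by
  have hs := summable_overlapTerm hρ hσ hT
  have key : ∀ j k, HasSum (fun p : ℕ × ℕ => overlapTerm ρ σ T ((j, k), p))
      ((starRingEnd ℂ) (entry (loss T σ) k j) * entry (loss T ρ) k j) := by
    intro j k
    have e1 := hρ.hasSum_entry_loss hT k j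
    have e2 := (hσ.hasSum_entry_loss hT k j).map (starRingEnd ℂ) Complex.continuous_conj
    have hterm : ∀ p : ℕ × ℕ, overlapTerm ρ σ T ((j, k), p) =
        ((lossAmp T k p.1 * lossAmp T j p.1 : ℝ) : ℂ) * entry ρ (k + p.1) (j + p.1) *
        ((starRingEnd ℂ) ∘ fun l => ((lossAmp T k l * lossAmp T j l : ℝ) : ℂ) *
          entry σ (k + l) (j + l)) p.2 := by
      intro p
      simp only [Function.comp, map_mul, conj_entry hσ.isPositive, Complex.conj_ofReal,
        overlapTerm]
      push_cast
      ring
    rw [mul_comm]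
    simp only [hterm]
    refine e1.mul e2 ?_
    simp only [← hterm]
    exact hs.prod_factor (j, k)
  have h1 := hs.hasSum.prod_fiberwise fun p => key p.1 p.2
  have h2 := h1.summable.hasSum.prod_fiberwise fun j => (h1.summable.prod_factor j).hasSum
  rw [h1.tsum_eq] at h2
  rw [hsInner_eq_tsum, h2.tsum_eq]
  exact hs.hasSum

/-! ### Sorting sums by total photon number -/

/-- Grouping the terms of a sum according to a map with finite fibres. -/
theorem hasSum_sum_of_mem_iff {X Y : Type*} {f : X → ℂ} {s : ℂ} (h : HasSum f s)
    (g : X → Y) (F : Y → Finset X) (hF : ∀ x y, x ∈ F y ↔ g x = y) :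
    HasSum (fun y => ∑ x ∈ F y, f x) s := by
  refine (h.tsum_fiberwise g).congr_fun fun y => ?_
  have hset : g ⁻¹' {y} = (F y : Set X) := by
    ext x
    simp [hF]
  rw [hset, Finset.tsum_subtype']

theorem hasSum_antidiagonal {f : ℕ × ℕ → ℂ} {s : ℂ} (h : HasSum f s) :
    HasSum (fun N => ∑ p ∈ antidiagonal N, f p) s :=
  hasSum_sum_of_mem_iff h (fun p => p.1 + p.2) _ fun _ _ => mem_antidiagonal

theorem hasSum_antidiagonal_quadruple {f : (ℕ × ℕ) × (ℕ × ℕ) → ℂ} {s : ℂ} (h : HasSum f s) :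
    HasSum (fun N => ∑ p ∈ antidiagonal N, ∑ q ∈ antidiagonal p.1, ∑ r ∈ antidiagonal p.2,
      f (q, r)) s := by
  refine hasSum_antidiagonal ((hasSum_sum_of_mem_iff h
    (fun x => (x.1.1 + x.1.2, x.2.1 + x.2.2)) (fun p => antidiagonal p.1 ×ˢ antidiagonal p.2)
    fun x y => ?_).congr_fun fun p => ?_)
  · rw [Finset.mem_product, mem_antidiagonal, mem_antidiagonal, Prod.ext_iff]
  · rw [Finset.sum_product]

open Polynomial TensorProduct

/-! ### A generating function identity in `ℂ[X] ⊗ ℂ[X]` -/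

/-- The linear functional on `ℂ[X] ⊗ ℂ[X]` with value `G m n` at `X ^ m ⊗ X ^ n`. -/
def pairing (G : ℕ → ℕ → ℂ) : ℂ[X] ⊗[ℂ] ℂ[X] →ₗ[ℂ] ℂ :=
  TensorProduct.lift (Polynomial.lsum fun m =>
    LinearMap.toSpanSingleton ℂ (ℂ[X] →ₗ[ℂ] ℂ)
      (Polynomial.lsum fun n => LinearMap.toSpanSingleton ℂ ℂ (G m n)))

theorem pairing_tmul (G : ℕ → ℕ → ℂ) (f g : ℂ[X]) :
    pairing G (f ⊗ₜ g) =
      ∑ m ∈ f.support, ∑ n ∈ g.support, f.coeff m * g.coeff n * G m n := by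
  simp [pairing, Polynomial.lsum_apply, Polynomial.sum_def, Finset.mul_sum, mul_assoc,
    LinearMap.sum_apply]

theorem pairing_X_pow (G : ℕ → ℕ → ℂ) (m n : ℕ) :
    pairing G ((X ^ m : ℂ[X]) ⊗ₜ (X ^ n : ℂ[X])) = G m n := by
  simp [pairing_tmul, Polynomial.support_X_pow]

/-- Multinomial expansion that sorts the photons of two modes into transmitted (`p.1`) and lost
(`p.2`) ones. The constant `1` is `1 ⊗ 1`. -/
theorem tmul_expand_transmitted (t : ℂ) (N : ℕ) :
    (t • ((1 : ℂ[X]) ⊗ₜ[ℂ] (X : ℂ[X]) + (X : ℂ[X]) ⊗ₜ[ℂ] (1 : ℂ[X])) +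
      (1 - t) • ((X : ℂ[X]) ⊗ₜ[ℂ] (X : ℂ[X]) + 1)) ^ N =
    ∑ p ∈ antidiagonal N, ∑ q ∈ antidiagonal p.1, ∑ r ∈ antidiagonal p.2,
      (t ^ p.1 * (1 - t) ^ p.2 * (N.choose p.1 * (p.1.choose q.1 * p.2.choose r.1) : ℕ)) •
        ((X ^ (q.2 + r.1) : ℂ[X]) ⊗ₜ[ℂ] (X ^ (q.1 + r.1) : ℂ[X])) := by
  rw [(Commute.all _ _).add_pow']
  refine Finset.sum_congr rfl fun p _ => ?_
  rw [_root_.smul_pow, _root_.smul_pow, (Commute.all _ _).add_pow' p.1,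
    (Commute.all _ _).add_pow' p.2,
    smul_mul_smul_comm, Finset.sum_mul_sum, Finset.smul_sum, Finset.smul_sum]
  refine Finset.sum_congr rfl fun q _ => ?_
  rw [Finset.smul_sum, Finset.smul_sum]
  refine Finset.sum_congr rfl fun r _ => ?_
  rw [Algebra.TensorProduct.tmul_pow, Algebra.TensorProduct.tmul_pow,
    Algebra.TensorProduct.tmul_pow, Algebra.TensorProduct.tmul_mul_tmul, one_pow, one_pow,
    one_pow, one_mul, mul_one, mul_one, smul_mul_smul_comm,
    Algebra.TensorProduct.tmul_mul_tmul, ← pow_add, ← pow_add]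
  simp only [← Nat.cast_smul_eq_nsmul ℂ, smul_smul]
  congr 1
  push_cast
  ring

/-- The same power, expanded after diagonalization: the sum over the numbers `p.1` and `p.2` of
photons in the symmetric and in the antisymmetric mode. -/
theorem tmul_expand_modes (t : ℂ) (N : ℕ) :
    (t • ((1 : ℂ[X]) ⊗ₜ[ℂ] (X : ℂ[X]) + (X : ℂ[X]) ⊗ₜ[ℂ] (1 : ℂ[X])) +
      (1 - t) • ((X : ℂ[X]) ⊗ₜ[ℂ] (X : ℂ[X]) + 1)) ^ N =
    ∑ p ∈ antidiagonal N, ((1 - 2 * t) ^ p.2 * ((1 / 2) ^ N * N.choose p.1)) •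
      (((1 + X) ^ p.1 * (1 - X) ^ p.2 : ℂ[X]) ⊗ₜ[ℂ]
        ((1 + X) ^ p.1 * (1 - X) ^ p.2 : ℂ[X])) := by
  have h : t • ((1 : ℂ[X]) ⊗ₜ[ℂ] (X : ℂ[X]) + (X : ℂ[X]) ⊗ₜ[ℂ] (1 : ℂ[X])) +
      (1 - t) • ((X : ℂ[X]) ⊗ₜ[ℂ] (X : ℂ[X]) + 1) =
      (1 / 2 : ℂ) • ((1 + X : ℂ[X]) ⊗ₜ[ℂ] (1 + X : ℂ[X])) +
        ((1 - 2 * t) * (1 / 2) : ℂ) • ((1 - X : ℂ[X]) ⊗ₜ[ℂ] (1 - X : ℂ[X])) := by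
    simp only [TensorProduct.add_tmul, TensorProduct.tmul_add, TensorProduct.sub_tmul,
      TensorProduct.tmul_sub, Algebra.TensorProduct.one_def]
    module
  rw [h, (Commute.all _ _).add_pow']
  refine Finset.sum_congr rfl fun p hp => ?_
  rw [_root_.smul_pow, _root_.smul_pow, smul_mul_smul_comm, Algebra.TensorProduct.tmul_pow,
    Algebra.TensorProduct.tmul_pow, Algebra.TensorProduct.tmul_mul_tmul,
    ← Nat.cast_smul_eq_nsmul ℂ, smul_smul, ← mem_antidiagonal.1 hp, mul_pow, pow_add]
  congr 1
  ring

/-! ### Multinomial coefficients and loss amplitudes -/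

theorem choose_mul_choose_mul_choose_mul_factorial (a b c d : ℕ) :
    ((a + b + (c + d)).choose (a + b) * ((a + b).choose a * (c + d).choose c)) *
      (a.factorial * b.factorial * (c.factorial * d.factorial)) =
      (a + b + (c + d)).factorial := by
  have h1 := Nat.add_choose_mul_factorial_mul_factorial a b
  have h2 := Nat.add_choose_mul_factorial_mul_factorial c d
  have h3 := Nat.add_choose_mul_factorial_mul_factorial (a + b) (c + d)
  rw [← Nat.choose_symm_add] at h1 h2 h3
  rw [← h3, ← h1, ← h2]
  ring

/-- The two sides are the same multinomial coefficient. -/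
theorem multinomial_swap (j k l l' : ℕ) :
    (j + k + (l + l')).choose (j + k) * ((j + k).choose j * (l + l').choose l) =
      (j + k + (l + l')).choose (k + l) * ((k + l).choose k * (j + l').choose j) := by
  have h1 := choose_mul_choose_mul_choose_mul_factorial j k l l'
  have h2 := choose_mul_choose_mul_choose_mul_factorial k l j l'
  have e : k + l + (j + l') = j + k + (l + l') := by ring
  rw [e] at h2
  have hpos : 0 < j.factorial * k.factorial * (l.factorial * l'.factorial) := by positivity
  refine Nat.eq_of_mul_eq_mul_right hpos ?_
  rw [h1, ← h2]
  ring

/-- The four binomial loss amplitudes multiply to a multinomial probability, up to the norms of the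
two-mode Fock states involved. -/
theorem lossAmp_mul_four {T : ℝ} (hT : T ∈ Set.Icc (0 : ℝ) 1) (j k l l' : ℕ) :
    lossAmp T k l * lossAmp T j l * (lossAmp T j l' * lossAmp T k l') *
      (√((j + k + (l + l')).choose (k + l) : ℝ) * √((j + k + (l + l')).choose (j + l) : ℝ)) =
    T ^ (j + k) * (1 - T) ^ (l + l') *
      ((j + k + (l + l')).choose (j + k) * ((j + k).choose j * (l + l').choose l) : ℕ) := by
  set M := (j + k + (l + l')).choose (j + k) * ((j + k).choose j * (l + l').choose l) with hM
  have h1 : √(M : ℝ) = √((j + k + (l + l')).choose (k + l) : ℝ) *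
      (√((k + l).choose k : ℝ) * √((j + l').choose j : ℝ)) := by
    rw [hM, multinomial_swap]
    push_cast
    rw [Real.sqrt_mul (by positivity), Real.sqrt_mul (by positivity)]
  have h2 : √(M : ℝ) = √((j + k + (l + l')).choose (j + l) : ℝ) *
      (√((j + l).choose j : ℝ) * √((k + l').choose k : ℝ)) := by
    have hsymm : M =
        (k + j + (l + l')).choose (k + j) * ((k + j).choose k * (l + l').choose l) := by
      rw [hM, add_comm k j, ← Nat.choose_symm_add (a := j) (b := k)]
    rw [hsymm, multinomial_swap, add_comm k j]
    push_cast
    rw [Real.sqrt_mul (by positivity), Real.sqrt_mul (by positivity)]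
  have h3 : (M : ℝ) = √(M : ℝ) * √(M : ℝ) := (Real.mul_self_sqrt (by positivity)).symm
  have hT1 : T = √T * √T := (Real.mul_self_sqrt hT.1).symm
  have hT2 : 1 - T = √(1 - T) * √(1 - T) :=
    (Real.mul_self_sqrt (by linarith [hT.2])).symm
  rw [h3]
  nth_rw 1 [h1]
  rw [h2]
  conv_rhs => rw [hT2]; enter [1, 1]; rw [hT1]
  simp only [lossAmp]
  ring

/-! ### Sectors of fixed total photon number -/

/-- The matrix elements of `ρ ⊗ σ` on the sector with `N` photons, between the unnormalized Fock
states `|n, N - n⟩ / √(N choose n)`, which the monomials `X ^ n` stand for. For `n > N` the binomial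
coefficient and hence the value is `0`. -/
def sectorForm (ρ σ : OneMode →L[ℂ] OneMode) (N m n : ℕ) : ℂ :=
  entry ρ m n * entry σ (N - m) (N - n) / ((√(N.choose m : ℝ) * √(N.choose n : ℝ) : ℝ) : ℂ)

/-- The probability of finding `b` photons in the symmetric and `r` photons in the antisymmetric
output of a balanced beam splitter fed with `ρ ⊗ σ`. The polynomial `(1 + X) ^ b * (1 - X) ^ r`
stands for the corresponding two-mode state. -/
def modeProb (ρ σ : OneMode →L[ℂ] OneMode) (p : ℕ × ℕ) : ℂ :=
  (1 / 2) ^ (p.1 + p.2) * (p.1 + p.2).choose p.1 *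
    pairing (sectorForm ρ σ (p.1 + p.2))
      (((1 + X) ^ p.1 * (1 - X) ^ p.2 : ℂ[X]) ⊗ₜ[ℂ] ((1 + X) ^ p.1 * (1 - X) ^ p.2 : ℂ[X]))

open scoped ComplexOrder in
/-- For a polynomial with real coefficients, the pairing is a value of the quadratic form of the
entrywise product of a matrix of `ρ` and a matrix of `σ`, both positive semidefinite. -/
theorem pairing_sectorForm_nonneg {ρ σ : OneMode →L[ℂ] OneMode} (hρ : ρ.IsPositive)
    (hσ : σ.IsPositive) (N : ℕ) {f : ℂ[X]} (hf : f.map (starRingEnd ℂ) = f) :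
    0 ≤ pairing (sectorForm ρ σ N) (f ⊗ₜ f) := by
  have h := ((posSemidef_entry hρ fun m : f.support => (m : ℕ)).hadamard
    (posSemidef_entry hσ fun m : f.support => N - (m : ℕ))).dotProduct_mulVec_nonneg
    fun m => f.coeff m / (√(N.choose m : ℝ) : ℝ)
  have hc : ∀ n, (starRingEnd ℂ) (f.coeff n) = f.coeff n := fun n => by
    rw [← Polynomial.coeff_map, hf]
  rw [pairing_tmul, ← Finset.sum_coe_sort f.support]
  convert! h using 1
  refine Finset.sum_congr rfl fun m _ => ?_
  rw [← Finset.sum_coe_sort f.support, Matrix.mulVec, dotProduct, Finset.mul_sum]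
  refine Finset.sum_congr rfl fun n _ => ?_
  simp only [sectorForm, Pi.star_apply, RCLike.star_def, map_div₀, hc, Complex.conj_ofReal,
    Matrix.hadamard_apply, Matrix.of_apply]
  push_cast
  simp only [div_eq_mul_inv, mul_inv]
  ring

open scoped ComplexOrder in
theorem modeProb_nonneg {ρ σ : OneMode →L[ℂ] OneMode} (hρ : IsState ρ) (hσ : IsState σ)
    (p : ℕ × ℕ) : 0 ≤ modeProb ρ σ p := by
  have h := pairing_sectorForm_nonneg hρ.isPositive hσ.isPositive (p.1 + p.2)
    (f := (1 + X) ^ p.1 * (1 - X) ^ p.2) (by simp)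
  have h2 : (0 : ℂ) ≤ (1 / 2) ^ (p.1 + p.2) * (p.1 + p.2).choose p.1 := by
    have : (0 : ℝ) ≤ (1 / 2) ^ (p.1 + p.2) * (p.1 + p.2).choose p.1 := by positivity
    simpa using Complex.zero_le_real.2 this
  exact mul_nonneg h2 h

theorem overlapTerm_eq_sectorForm (ρ σ : OneMode →L[ℂ] OneMode) {T : ℝ}
    (hT : T ∈ Set.Icc (0 : ℝ) 1) (j k l l' : ℕ) :
    overlapTerm ρ σ T ((j, k), (l, l')) =
      ((T : ℂ) ^ (j + k) * (1 - T) ^ (l + l') *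
        ((j + k + (l + l')).choose (j + k) * ((j + k).choose j * (l + l').choose l) : ℕ)) *
      sectorForm ρ σ (j + k + (l + l')) (k + l) (j + l) := by
  have h := congrArg (fun x : ℝ => (x : ℂ)) (lossAmp_mul_four hT j k l l')
  have hpos : ((√((j + k + (l + l')).choose (k + l) : ℝ) *
      √((j + k + (l + l')).choose (j + l) : ℝ) : ℝ) : ℂ) ≠ 0 := by
    have h1 : 0 < (j + k + (l + l')).choose (k + l) := Nat.choose_pos (by omega)
    have h2 : 0 < (j + k + (l + l')).choose (j + l) := Nat.choose_pos (by omega)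
    exact_mod_cast (by positivity : (0 : ℝ) < √((j + k + (l + l')).choose (k + l) : ℝ) *
      √((j + k + (l + l')).choose (j + l) : ℝ)).ne'
  have e1 : j + k + (l + l') - (k + l) = j + l' := by omega
  have e2 : j + k + (l + l') - (j + l) = k + l' := by omega
  rw [sectorForm, e1, e2, ← mul_div_assoc, eq_div_iff hpos, overlapTerm, mul_right_comm]
  congr 1
  exact_mod_cast h

/-- On the sector with `N` photons, the overlap is a polynomial in `1 - 2T` whose coefficients are
the probabilities `modeProb`. -/
theorem sum_overlapTerm_sector (ρ σ : OneMode →L[ℂ] OneMode) {T : ℝ}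
    (hT : T ∈ Set.Icc (0 : ℝ) 1) (N : ℕ) :
    ∑ p ∈ antidiagonal N, ∑ q ∈ antidiagonal p.1, ∑ r ∈ antidiagonal p.2,
      overlapTerm ρ σ T (q, r) =
    ∑ p ∈ antidiagonal N, (1 - 2 * (T : ℂ)) ^ p.2 * modeProb ρ σ p := by
  have h := congrArg (pairing (sectorForm ρ σ N))
    ((tmul_expand_transmitted (T : ℂ) N).symm.trans (tmul_expand_modes (T : ℂ) N))
  simp only [map_sum, map_smul, pairing_X_pow, smul_eq_mul] at h
  have e1 : ∀ p ∈ antidiagonal N, (1 - 2 * (T : ℂ)) ^ p.2 * modeProb ρ σ p =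
      (1 - 2 * (T : ℂ)) ^ p.2 * ((1 / 2) ^ N * N.choose p.1) *
        pairing (sectorForm ρ σ N) (((1 + X) ^ p.1 * (1 - X) ^ p.2 : ℂ[X]) ⊗ₜ[ℂ]
          ((1 + X) ^ p.1 * (1 - X) ^ p.2 : ℂ[X])) := fun p hp => by
    rw [modeProb, mem_antidiagonal.1 hp]
    ring
  rw [Finset.sum_congr rfl e1, ← h]
  refine Finset.sum_congr rfl fun p hp => Finset.sum_congr rfl fun q hq =>
    Finset.sum_congr rfl fun r hr => ?_
  obtain ⟨j, k⟩ := q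
  obtain ⟨l, l'⟩ := r
  obtain ⟨a, b⟩ := p
  have ha : j + k = a := mem_antidiagonal.1 hq
  have hb : l + l' = b := mem_antidiagonal.1 hr
  have hN : a + b = N := mem_antidiagonal.1 hp
  subst ha hb hN
  exact overlapTerm_eq_sectorForm ρ σ hT j k l l'

/-! ### The overlap as a power series -/

/-- The probabilities `modeProb` are summable: their sum is the overlap at `T = 0`. -/
theorem summable_re_modeProb {ρ σ : OneMode →L[ℂ] OneMode} (hρ : IsState ρ) (hσ : IsState σ) :
    Summable fun p => (modeProb ρ σ p).re := by
  have h0 : (0 : ℝ) ∈ Set.Icc (0 : ℝ) 1 := by simp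
  have h := hasSum_antidiagonal_quadruple (hasSum_overlapTerm hρ hσ h0)
  simp only [sum_overlapTerm_sector ρ σ h0, Complex.ofReal_zero, mul_zero, sub_zero, one_pow,
    one_mul] at h
  rw [summable_prod_iff_antidiagonal fun p => (Complex.le_def.1 (modeProb_nonneg hρ hσ p)).1]
  simpa only [Complex.re_sum] using (Complex.hasSum_re h).summable

theorem ofReal_re_modeProb {ρ σ : OneMode →L[ℂ] OneMode} (hρ : IsState ρ) (hσ : IsState σ)
    (p : ℕ × ℕ) : (((modeProb ρ σ p).re : ℝ) : ℂ) = modeProb ρ σ p :=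
  Complex.ext rfl (Complex.le_def.1 (modeProb_nonneg hρ hσ p)).2

/-- The probability of finding `r` photons in the antisymmetric output of a balanced beam splitter
fed with `ρ ⊗ σ`. -/
def antisymmProb (ρ σ : OneMode →L[ℂ] OneMode) (r : ℕ) : ℝ :=
  ∑' b, (modeProb ρ σ (b, r)).re

theorem antisymmProb_nonneg {ρ σ : OneMode →L[ℂ] OneMode} (hρ : IsState ρ) (hσ : IsState σ)
    (r : ℕ) : 0 ≤ antisymmProb ρ σ r :=
  tsum_nonneg fun b => (Complex.le_def.1 (modeProb_nonneg hρ hσ (b, r))).1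

/-- The overlap at transmission `T` is the generating function of the photon number distribution of
the antisymmetric output, evaluated at `1 - 2T`. The bound `|1 - 2T| ≤ 1` makes the double series
over `(b, r)` converge absolutely, so that it may be summed over `b` first. -/
theorem hasSum_overlap {ρ σ : OneMode →L[ℂ] OneMode} (hρ : IsState ρ) (hσ : IsState σ) {T : ℝ}
    (hT : T ∈ Set.Icc (0 : ℝ) 1) :
    HasSum (fun m => ((antisymmProb ρ σ m * (1 - 2 * T) ^ m : ℝ) : ℂ))
      (hsInner (loss T σ) (loss T ρ)) := by
  have hs := summable_re_modeProb hρ hσ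
  have hT' : |1 - 2 * T| ≤ 1 := abs_le.2 ⟨by linarith [hT.2], by linarith [hT.1]⟩
  have hsT : Summable fun p : ℕ × ℕ => (1 - 2 * T) ^ p.2 * (modeProb ρ σ p).re := by
    refine Summable.of_norm_bounded hs fun p => ?_
    rw [norm_mul, norm_pow, Real.norm_eq_abs, Real.norm_eq_abs,
      abs_of_nonneg (Complex.le_def.1 (modeProb_nonneg hρ hσ p)).1]
    exact mul_le_of_le_one_left (Complex.le_def.1 (modeProb_nonneg hρ hσ p)).1
      (pow_le_one₀ (abs_nonneg _) hT')
  have h1 := hasSum_antidiagonal_quadruple (hasSum_overlapTerm hρ hσ hT)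
  have h2 := hasSum_antidiagonal (Complex.hasSum_ofReal.2 hsT.hasSum)
  have h3 : hsInner (loss T σ) (loss T ρ) =
      ((∑' p : ℕ × ℕ, (1 - 2 * T) ^ p.2 * (modeProb ρ σ p).re : ℝ) : ℂ) := by
    refine h1.unique ?_
    simp only [sum_overlapTerm_sector ρ σ hT]
    simpa [ofReal_re_modeProb hρ hσ] using h2
  rw [h3]
  refine Complex.hasSum_ofReal.2 ?_
  have h4 : HasSum (fun p : ℕ × ℕ => (1 - 2 * T) ^ p.1 * (modeProb ρ σ p.swap).re)
      (∑' p : ℕ × ℕ, (1 - 2 * T) ^ p.2 * (modeProb ρ σ p).re) :=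
    (Equiv.prodComm ℕ ℕ).hasSum_iff.2 hsT.hasSum
  refine h4.prod_fiberwise fun r => ?_
  rw [mul_comm (antisymmProb ρ σ r)]
  exact (hs.prod_symm.prod_factor r).hasSum.mul_left _

/-! ### Monotonicity and convexity -/

/-- A power series in `1 - 2T` with nonnegative coefficients is nonincreasing on `[0, 1/2]`. -/
theorem antitoneOn_of_hasSum {p : ℕ → ℝ} (hp : ∀ m, 0 ≤ p m) {f : ℝ → ℝ}
    (hf : ∀ T ∈ Set.Icc (0 : ℝ) (1 / 2), HasSum (fun m => p m * (1 - 2 * T) ^ m) (f T)) :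
    AntitoneOn f (Set.Icc 0 (1 / 2)) := fun a ha b hb hab => by
  refine hasSum_le (fun m => ?_) (hf b hb) (hf a ha)
  exact mul_le_mul_of_nonneg_left
    (pow_le_pow_left₀ (by linarith [hb.2]) (by linarith) m) (hp m)

/-- A power series in `1 - 2T` with nonnegative coefficients is convex on `[0, 1/2]`. -/
theorem convexOn_of_hasSum {p : ℕ → ℝ} (hp : ∀ m, 0 ≤ p m) {f : ℝ → ℝ}
    (hf : ∀ T ∈ Set.Icc (0 : ℝ) (1 / 2), HasSum (fun m => p m * (1 - 2 * T) ^ m) (f T)) :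
    ConvexOn ℝ (Set.Icc 0 (1 / 2)) f := by
  refine ⟨convex_Icc _ _, fun x hx y hy a b ha hb hab => ?_⟩
  refine hasSum_le (fun m => ?_) (hf _ (convex_Icc _ _ hx hy ha hb hab))
    (((hf x hx).mul_left a).add ((hf y hy).mul_left b))
  have h := (convexOn_pow m).2 (x := 1 - 2 * x) (y := 1 - 2 * y)
    (by simp only [Set.mem_Ici]; linarith [hx.2]) (by simp only [Set.mem_Ici]; linarith [hy.2])
    ha hb hab
  have e : 1 - 2 * (a • x + b • y) = a • (1 - 2 * x) + b • (1 - 2 * y) := by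
    simp only [smul_eq_mul]
    linear_combination (-1 : ℝ) * hab
  rw [e]
  calc _ ≤ p m * (a • (1 - 2 * x) ^ m + b • (1 - 2 * y) ^ m) :=
        mul_le_mul_of_nonneg_left h (hp m)
    _ = _ := by simp only [smul_eq_mul]; ring

theorem purity_loss_eq {ρ : OneMode →L[ℂ] OneMode} (hρ : IsState ρ) (T : ℝ) :
    purity (loss T ρ) = (hsInner (loss T ρ) (loss T ρ)).re := by
  rw [purity, hsInner, hρ.isSelfAdjoint_loss]

theorem hasSum_overlap_re {ρ σ : OneMode →L[ℂ] OneMode} (hρ : IsState ρ) (hσ : IsState σ)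
    (T : ℝ) (hT : T ∈ Set.Icc (0 : ℝ) (1 / 2)) :
    HasSum (fun m => antisymmProb ρ σ m * (1 - 2 * T) ^ m)
      (hsInner (loss T σ) (loss T ρ)).re :=
  Complex.hasSum_re (hasSum_overlap hρ hσ ⟨hT.1, hT.2.trans (by norm_num)⟩)

end BosonicLoss

end

/-- The overlap of two lossy states and the purity of a lossy state: the overlap is a power series
in `1 - 2T` with nonnegative coefficients, and both are nonincreasing and convex for `T ≤ 1/2`. -/
theorem mainTheorem4
    (ρ σ : BosonicLoss.OneMode →L[ℂ] BosonicLoss.OneMode)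
    (hρ : BosonicLoss.IsState ρ) (hσ : BosonicLoss.IsState σ) :
    (∃ p : ℕ → ℝ, (∀ m, 0 ≤ p m) ∧
      ∀ T ∈ Set.Icc (0 : ℝ) 1,
        HasSum (fun m => ((p m * (1 - 2 * T) ^ m : ℝ) : ℂ))
          (BosonicLoss.hsInner (BosonicLoss.loss T σ) (BosonicLoss.loss T ρ))) ∧
    AntitoneOn
      (fun T : ℝ => (BosonicLoss.hsInner (BosonicLoss.loss T σ) (BosonicLoss.loss T ρ)).re)
      (Set.Icc 0 (1 / 2)) ∧
    ConvexOn ℝ (Set.Icc 0 (1 / 2))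
      (fun T : ℝ => (BosonicLoss.hsInner (BosonicLoss.loss T σ) (BosonicLoss.loss T ρ)).re) ∧
    AntitoneOn (fun T : ℝ => BosonicLoss.purity (BosonicLoss.loss T ρ)) (Set.Icc 0 (1 / 2)) ∧
    ConvexOn ℝ (Set.Icc 0 (1 / 2))
      (fun T : ℝ => BosonicLoss.purity (BosonicLoss.loss T ρ)) := by
  refine ⟨⟨BosonicLoss.antisymmProb ρ σ, BosonicLoss.antisymmProb_nonneg hρ hσ,
      fun T hT => BosonicLoss.hasSum_overlap hρ hσ hT⟩,
    BosonicLoss.antitoneOn_of_hasSum (BosonicLoss.antisymmProb_nonneg hρ hσ)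
      (BosonicLoss.hasSum_overlap_re hρ hσ),
    BosonicLoss.convexOn_of_hasSum (BosonicLoss.antisymmProb_nonneg hρ hσ)
      (BosonicLoss.hasSum_overlap_re hρ hσ), ?_, ?_⟩
  · simp only [BosonicLoss.purity_loss_eq hρ]
    exact BosonicLoss.antitoneOn_of_hasSum (BosonicLoss.antisymmProb_nonneg hρ hρ)
      (BosonicLoss.hasSum_overlap_re hρ hρ)
  · simp only [BosonicLoss.purity_loss_eq hρ]
    exact BosonicLoss.convexOn_of_hasSum (BosonicLoss.antisymmProb_nonneg hρ hρ)
      (BosonicLoss.hasSum_overlap_re hρ hρ)
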